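/- Setting. A depth-$d$ 1D-QAC circuit on a line of $m$ qubits is a unitary $C=L_dM_d\cdots L_1M_1L_0$, where each $L_k$ is a tensor product of arbitrary single-qubit unitaries and each $M_k$ is a product of $\mathrm{CZ}$ gates whose supports are pairwise disjoint nonempty intervals of consecutive qubits; the $\mathrm{CZ}$ gate with support $T$ multiplies a computational basis state by $-1$ if all qubits of $T$ are $1$ and fixes it otherwise. A set $I$ of $n$ of the $m$ qubits, at arbitrary positions, carries the input; the set $A$ of the other qubits (arbitrarily many) consists of ancillas initialised to $|0\rangle_A$. For $x\in\{0,1\}^I$ let $|\rho_C^x\rangle = C\,(|x\rangle_I|0\rangle_A)$ and $\rho_C^x=|\rho_C^x\rangle\langle\rho_C^x|$, and let $\bar x$ be the bitwise complement of $x$. An input-dependent nekomata state is $|\sigma^x\rangle=\frac1{\sqrt2}\big(|x\rangle_I|\psi_{x,0}\rangle_A+|\bar x\rangle_I|\psi_{x,1}\rangle_A\big)$ with $|\psi_{x,0}\rangle,|\psi_{x,1}\rangle$ arbitrary unit vectors on $A$; write $\sigma^x=|\sigma^x\rangle\langle\sigma^x|$. Let $\|M\|_1=\mathrm{Tr}\sqrt{M^\dagger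 M}$ be the (unnormalised) trace norm, and let $\mathbb E_x$ be the average over uniform $x\in\{0,1\}^I$. Theorem. There is an absolute constant $c>0$ such that the following holds for all integers $n,d\ge1$ and all $0<\varepsilon<1$. Put $t=\log_2(n/\varepsilon)$. For every depth-$d$ 1D-QAC circuit $C$ with a set $I$ of $n$ input qubits and ancilla qubits $A$, and for every family $(\sigma^x)_{x\in\{0,1\}^I}$ of input-dependent nekomata states, $$\mathbb E_x\big\|\mathrm{Tr}_A[\rho_C^x]-\mathrm{Tr}_A[\sigma^x]\big\|_1\;\ge\;\frac18-2^{-c\,(n/t^d-1)}-16\,d\,\varepsilon .$$ In particular, for the in-place input-dependent cat states $|\mathrm{Cat}_x\rangle=\frac1{\sqrt2}(|x\rangle+|\bar x\rangle)$ on the input qubits, $$\mathbb E_x\big\|\mathrm{Tr}_A[\rho_C^x]-|\mathrm{Cat}_x\rangle\langle \mathrm{Cat}_x|\big\|_1\;\ge\;\frac18-2^{-c\,(n/t^d-1)}-16\,d\,\varepsilon .$$ -/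

import Mathlib

namespace QACLine

/-- Classical bit strings on a register whose qubits are labelled by `V`. -/
abbrev Bits (V : Type*) := V → Bool

/-- A (not necessarily normalised) vector of the Hilbert space of the register `V`, written in the
computational basis. -/
abbrev Ket (V : Type*) := Bits V → ℂ

/-- An operator on the Hilbert space of the register `V`, written in the computational basis. -/
abbrev Op (V : Type*) := Matrix (Bits V) (Bits V) ℂ

/-- The ket is a pure state: `∑ |ψ z|² = 1`. -/
def IsUnitKet {V : Type*} [Fintype V] [DecidableEq V] (ψ : Ket V) : Prop :=
  ∑ z, ‖ψ z‖ ^ 2 = 1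

/-- The computational basis vector `|x⟩`. -/
def basisKet {V : Type*} [Fintype V] [DecidableEq V] (x : Bits V) : Ket V :=
  fun z => if z = x then 1 else 0

/-- The operator `|ψ⟩⟨ψ|`. -/
def proj {V : Type*} (ψ : Ket V) : Op V :=
  Matrix.vecMulVec ψ (star ψ)

/-- The bitwise complement `x̄`. -/
def compl {V : Type*} (x : Bits V) : Bits V := fun i => !(x i)

/-- The (unnormalised) trace norm `‖M‖₁ = Tr √(M† M)`: the sum of the singular values of `M`. -/
noncomputable def traceNorm {κ : Type*} [Fintype κ] [DecidableEq κ] (M : Matrix κ κ ℂ) : ℝ :=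
  ∑ k, Real.sqrt ((Matrix.isHermitian_conjTranspose_mul_self M).eigenvalues k)

/-! ### Circuits on a line of `m` qubits -/

/-- A layer of arbitrary single-qubit unitaries, one for each of the `m` qubits. -/
abbrev SingleLayer (m : ℕ) := Fin m → Matrix.unitaryGroup Bool ℂ

/-- The tensor product of the single-qubit unitaries of a layer. -/
def SingleLayer.op {m : ℕ} (L : SingleLayer m) : Op (Fin m) :=
  fun z w => ∏ i, (L i : Matrix Bool Bool ℂ) (z i) (w i)

/-- The diagonal entry at `z` of the `CZ` gate with support `T`: it is `-1` if all the qubits of `T`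
are `1`, and `1` otherwise. -/
def czPhase {m : ℕ} (T : Finset (Fin m)) (z : Bits (Fin m)) : ℂ :=
  if ∀ i ∈ T, z i = true then -1 else 1

/-- The `CZ` gate with support `T` (tensored with the identity on the other qubits). -/
def czGate {m : ℕ} (T : Finset (Fin m)) : Op (Fin m) :=
  Matrix.diagonal (czPhase T)

/-- A layer of `CZ` gates of arbitrary sizes, given by the set of their supports: pairwise disjoint
nonempty intervals of consecutive qubits of the line. -/
structure CZLayer (m : ℕ) where
  supports : Finset (Finset (Fin m))
  interval : ∀ T ∈ supports, ∃ a b : Fin m, a ≤ b ∧ T = Finset.Icc a b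
  disjoint : ∀ T ∈ supports, ∀ T' ∈ supports, T ≠ T' → Disjoint T T'

/-- The product of the (commuting, diagonal) `CZ` gates of a layer. -/
def CZLayer.op {m : ℕ} (M : CZLayer m) : Op (Fin m) :=
  Matrix.diagonal fun z => ∏ T ∈ M.supports, czPhase T z

/-- The operator of a layer is built by multiplying its gates together. -/
theorem diagonal_prod_insert {m : ℕ} (T : Finset (Fin m)) (s : Finset (Finset (Fin m)))
    (hT : T ∉ s) :
    Matrix.diagonal (fun z => ∏ T' ∈ insert T s, czPhase T' z) =
      czGate T * Matrix.diagonal (fun z => ∏ T' ∈ s, czPhase T' z) := by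
  simp [czGate, Finset.prod_insert hT]

/-- One-dimensional `QAC` circuits `L_d M_d ⋯ L_1 M_1 L_0` on `m` qubits, where the `L_k` are layers
of single-qubit unitaries and the `M_k` are layers of `CZ` gates. The depth `d` is the number of
`CZ` layers. -/
inductive Circuit (m : ℕ) : ℕ → Type
  | base (L : SingleLayer m) : Circuit m 0
  | step {d : ℕ} (C : Circuit m d) (M : CZLayer m) (L : SingleLayer m) : Circuit m (d + 1)

/-- The unitary operator that a circuit performs. -/
def Circuit.op {m : ℕ} : {d : ℕ} → Circuit m d → Op (Fin m)
  | _, .base L => L.op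
  | _, .step C M L => L.op * M.op * C.op

/-! ### Input and ancilla qubits

The input qubits form an arbitrary set `I` of positions on the line; all the other qubits are
ancillas. -/

/-- The ancilla qubits `A`. -/
abbrev Anc {m : ℕ} (I : Finset (Fin m)) := {i : Fin m // i ∉ I}

/-- The string on all qubits which is `x` on the input qubits and `a` on the ancillas. -/
def join {m : ℕ} (I : Finset (Fin m)) (x : Bits I) (a : Bits (Anc I)) : Bits (Fin m) :=
  fun i => if h : i ∈ I then x ⟨i, h⟩ else a ⟨i, h⟩

/-- The product vector `|φ⟩_I |ψ⟩_A`. -/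
def tensor {m : ℕ} (I : Finset (Fin m)) (φ : Ket I) (ψ : Ket (Anc I)) : Ket (Fin m) :=
  fun z => φ (fun i => z i) * ψ (fun i => z i)

/-- The partial trace `Tr_A` over the ancilla qubits. -/
def traceAnc {m : ℕ} (I : Finset (Fin m)) (M : Op (Fin m)) : Op I :=
  fun x y => ∑ a : Bits (Anc I), M (join I x a) (join I y a)

/-- The output state `C (|x⟩_I |0⟩_A)` of the circuit. -/
def Circuit.output {m d : ℕ} (C : Circuit m d) (I : Finset (Fin m)) (x : Bits I) : Ket (Fin m) :=
  C.op.mulVec (tensor I (basisKet x) (basisKet fun _ => false))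

/-- The input-dependent cat state `(|x⟩ + |x̄⟩) / √2` on the input qubits. -/
noncomputable def catKet {m : ℕ} (I : Finset (Fin m)) (x : Bits I) : Ket I :=
  ((Real.sqrt 2 : ℝ) : ℂ)⁻¹ • (basisKet x + basisKet (compl x))

/-- The input-dependent nekomata state `(|x⟩_I |ψ₀⟩_A + |x̄⟩_I |ψ₁⟩_A) / √2`. -/
noncomputable def nekomataKet {m : ℕ} (I : Finset (Fin m)) (x : Bits I)
    (ψ₀ ψ₁ : Ket (Anc I)) : Ket (Fin m) :=
  ((Real.sqrt 2 : ℝ) : ℂ)⁻¹ • (tensor I (basisKet x) ψ₀ + tensor I (basisKet (compl x)) ψ₁)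

/-- The average of `f` over uniformly random inputs `x ∈ {0,1}^I`. -/
noncomputable def expect {m : ℕ} (I : Finset (Fin m)) (f : Bits I → ℝ) : ℝ :=
  (∑ x, f x) / 2 ^ I.card

end QACLine

/-! Measuring the qubits of the support of a `CZ` gate reveals every input whose forward light cone
ends inside the support. If there are `τ` such inputs then, for a random input of the circuit, the
qubits are all `1` with probability at most `2 ^ (-τ)`, so that deleting the gate hardly changes the
output. The gates that are left confine few inputs. A layer has at most one gate that straddles a
given cut of the line, and beyond the inputs confined by that gate only those that crossed the line
at one of its two ends can cross the cut, so that the number of inputs crossing a cut at most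
doubles, roughly, with each layer. When there are more inputs than that, the light cones of the
leftmost and the rightmost input position are disjoint intervals and the two output bits are
uncorrelated, whereas in a nekomata state each of them is unbiased and they determine one
another. -/

namespace QACLine

open scoped BigOperators symmDiff
open WithLp (toLp)

section LocalOperators

variable {V : Type*} {S T : Finset V} {A B : Op V}

/-- The operator `A` acts only on the qubits of `S`, i.e. `A = A' ⊗ 1`: its entry at `(z, w)`
vanishes unless `z = w` off `S`, and does not change when `z` and `w` are flipped at the same
qubits off `S`. -/
structure SupportedOn (S : Finset V) (A : Op V) : Prop where
  eq_of_ne_zero : ∀ {z w}, A z w ≠ 0 → ∀ i ∉ S, z i = w i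
  apply_symmDiff : ∀ {s : Bits V}, (∀ i ∈ S, s i = false) → ∀ z w, A (z ∆ s) (w ∆ s) = A z w

theorem supportedOn_diagonal [DecidableEq (Bits V)] {f : Bits V → ℂ}
    (hf : DependsOn f (S : Set V)) : SupportedOn S (Matrix.diagonal f) where
  eq_of_ne_zero {z w} hzw i _ := by
    by_contra hne
    exact hzw (Matrix.diagonal_apply_ne _ fun h => hne (congrFun h i))
  apply_symmDiff {s} hs z w := by
    by_cases hzw : z = w
    · subst hzw
      rw [Matrix.diagonal_apply_eq, Matrix.diagonal_apply_eq]
      exact hf fun i hi => by simp [hs i hi]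
    · rw [Matrix.diagonal_apply_ne _ hzw,
        Matrix.diagonal_apply_ne _ fun h => hzw (symmDiff_left_injective s h)]

namespace SupportedOn

theorem mono (hA : SupportedOn S A) (h : S ⊆ T) : SupportedOn T A :=
  ⟨fun hzw i hi => hA.eq_of_ne_zero hzw i fun hS => hi (h hS),
    fun hs => hA.apply_symmDiff fun i hi => hs i (h hi)⟩

theorem star (hA : SupportedOn S A) : SupportedOn S (star A) where
  eq_of_ne_zero hzw i hi :=
    (hA.eq_of_ne_zero (star_ne_zero.1 hzw) i hi).symm
  apply_symmDiff hs z w := congrArg Star.star (hA.apply_symmDiff hs w z)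

theorem apply_congr (hA : SupportedOn S A) {z w z' w' : Bits V} (hz : ∀ i ∈ S, z i = z' i)
    (hw : ∀ i ∈ S, w i = w' i) (h : ∀ i ∉ S, z i = w i) (h' : ∀ i ∉ S, z' i = w' i) :
    A z w = A z' w' := by
  have hw' : w ∆ (z ∆ z') = w' := by
    funext i
    by_cases hi : i ∈ S
    · simp [hz i hi, hw i hi]
    · simp [h i hi, h' i hi]
  rw [← hA.apply_symmDiff (s := z ∆ z') (fun i hi => by simp [hz i hi]),
    symmDiff_symmDiff_cancel_left, hw']

variable [Fintype V] [DecidableEq V]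

theorem mul (hA : SupportedOn S A) (hB : SupportedOn S B) : SupportedOn S (A * B) where
  eq_of_ne_zero {z w} h i hi := by
    rw [Matrix.mul_apply] at h
    obtain ⟨v, -, hv⟩ := Finset.exists_ne_zero_of_sum_ne_zero h
    exact (hA.eq_of_ne_zero (left_ne_zero_of_mul hv) i hi).trans
      (hB.eq_of_ne_zero (right_ne_zero_of_mul hv) i hi)
  apply_symmDiff {s} hs z w := by
    rw [Matrix.mul_apply, Matrix.mul_apply,
      ← Equiv.sum_comp (symmDiff_left_involutive s).toPerm]
    exact Finset.sum_congr rfl fun v _ =>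
      congrArg₂ _ (hA.apply_symmDiff hs z v) (hB.apply_symmDiff hs v w)

theorem mul_apply_of_disjoint (hA : SupportedOn S A) (hB : SupportedOn T B) (h : Disjoint S T)
    (z w : Bits V) :
    (A * B) z w = A z (S.piecewise w z) * B (S.piecewise w z) w := by
  rw [Matrix.mul_apply]
  refine Finset.sum_eq_single _ (fun v _ hv => ?_) (by simp)
  by_contra h0
  refine hv (funext fun i => ?_)
  by_cases hi : i ∈ S
  · rw [Finset.piecewise_eq_of_mem _ _ _ hi]
    exact hB.eq_of_ne_zero (right_ne_zero_of_mul h0) i (Finset.disjoint_left.1 h hi)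
  · rw [Finset.piecewise_eq_of_notMem _ _ _ hi]
    exact (hA.eq_of_ne_zero (left_ne_zero_of_mul h0) i hi).symm

theorem mul_apply_self_of_disjoint (hA : SupportedOn S A) (hB : SupportedOn T B)
    (h : Disjoint S T) (z : Bits V) : (A * B) z z = A z z * B z z := by
  rw [hA.mul_apply_of_disjoint hB h, Finset.piecewise_same]

theorem mul_comm (hA : SupportedOn S A) (hB : SupportedOn T B) (h : Disjoint S T) :
    A * B = B * A := by
  have hST : ∀ {i}, i ∈ S → i ∉ T := fun hS hT => Finset.disjoint_left.1 h hS hT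
  ext z w
  rw [hA.mul_apply_of_disjoint hB h, hB.mul_apply_of_disjoint hA h.symm, _root_.mul_comm]
  by_cases hzw : ∀ i, i ∉ S → i ∉ T → z i = w i
  · congr 1
    · apply hB.apply_congr <;> grind [Finset.piecewise]
    · apply hA.apply_congr <;> grind [Finset.piecewise]
  · push Not at hzw
    obtain ⟨i, hS, hT, hne⟩ := hzw
    rw [show B (S.piecewise w z) w = 0 by
        by_contra h0
        exact hne (by simpa [hS] using hB.eq_of_ne_zero h0 i hT),
      show A (T.piecewise w z) w = 0 by
        by_contra h0
        exact hne (by simpa [hT] using hA.eq_of_ne_zero h0 i hS), zero_mul, mul_zero]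

end SupportedOn

/-- In the Heisenberg picture the unitary `U` maps observables on `S` to observables on `P`: up to
a unitary acting off `S` afterwards, `U` acts only on `P`. -/
structure HasLightCone [Fintype V] [DecidableEq V] (S P : Finset V) (U : Op V) : Prop where
  subset : S ⊆ P
  exists_eq_mul : ∃ W ∈ Matrix.unitaryGroup (Bits V) ℂ, ∃ X ∈ Matrix.unitaryGroup (Bits V) ℂ,
    SupportedOn Sᶜ W ∧ SupportedOn P X ∧ U = W * X

namespace HasLightCone

variable [Fintype V] [DecidableEq V] {P Q : Finset V} {U U' : Op V}

theorem mul (hU : HasLightCone S Q U) (hU' : HasLightCone Q P U') :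
    HasLightCone S P (U * U') := by
  obtain ⟨W, hW, X, hX, sW, sX, rfl⟩ := hU.exists_eq_mul
  obtain ⟨W', hW', X', hX', sW', sX', rfl⟩ := hU'.exists_eq_mul
  refine ⟨hU.subset.trans hU'.subset, W * W', mul_mem hW hW', X * X', mul_mem hX hX',
    sW.mul (sW'.mono (Finset.compl_subset_compl.2 hU.subset)), (sX.mono hU'.subset).mul sX', ?_⟩
  rw [mul_assoc W, ← mul_assoc X, sX.mul_comm sW' disjoint_compl_right]
  simp only [mul_assoc]

theorem supportedOn_star_mul_mul (hU : HasLightCone S P U) (hA : SupportedOn S A) :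
    SupportedOn P (star U * A * U) := by
  obtain ⟨W, hW, X, -, sW, sX, rfl⟩ := hU.exists_eq_mul
  have hWAW : star W * A * W = A := by
    rw [mul_assoc, hA.mul_comm sW disjoint_compl_right, ← mul_assoc,
      Matrix.mem_unitaryGroup_iff'.1 hW, one_mul]
  have hUAU : star (W * X) * A * (W * X) = star X * (star W * A * W) * X := by
    simp only [star_mul, mul_assoc]
  rw [hUAU, hWAW]
  exact (sX.star.mul (hA.mono hU.subset)).mul sX

end HasLightCone

end LocalOperators

section Layers

variable {m d : ℕ} {S T : Finset (Fin m)}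

namespace SingleLayer

theorem op_mul (L L' : SingleLayer m) : SingleLayer.op (L * L') = L.op * L'.op := by
  ext z w
  simp only [SingleLayer.op, Matrix.mul_apply, Pi.mul_apply, Submonoid.coe_mul,
    Finset.prod_univ_sum, ← Finset.prod_mul_distrib, Fintype.piFinset_univ]

theorem op_one : SingleLayer.op (1 : SingleLayer m) = 1 := by
  ext z w
  simp only [SingleLayer.op, Pi.one_apply, OneMemClass.coe_one, Matrix.one_apply,
    Finset.prod_ite_zero, Finset.prod_const_one, Finset.mem_univ, true_imp_iff, funext_iff]

theorem star_op (L : SingleLayer m) : star L.op = SingleLayer.op (star L) := by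
  ext z w
  simp [SingleLayer.op, Matrix.star_apply]

theorem op_mem_unitaryGroup (L : SingleLayer m) :
    L.op ∈ Matrix.unitaryGroup (Bits (Fin m)) ℂ := by
  have hL : star L * L = 1 := funext fun i => Unitary.star_mul_self (L i)
  rw [Matrix.mem_unitaryGroup_iff', star_op, ← op_mul, hL, op_one]

/-- The layer obtained from `L` by replacing the unitaries on the qubits outside `S` by `1`. -/
def restrict (L : SingleLayer m) (S : Finset (Fin m)) : SingleLayer m := S.piecewise L 1

theorem restrict_compl_mul_restrict (L : SingleLayer m) (S : Finset (Fin m)) :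
    L.restrict Sᶜ * L.restrict S = L := by
  funext i
  by_cases h : i ∈ S <;> simp [restrict, h]

theorem supportedOn_restrict_op (L : SingleLayer m) (S : Finset (Fin m)) :
    SupportedOn S (L.restrict S).op where
  eq_of_ne_zero h i hi := by
    have := Finset.prod_ne_zero_iff.1 h i (Finset.mem_univ i)
    by_contra hne
    simp [restrict, hi, hne] at this
  apply_symmDiff hs z w := by
    refine Finset.prod_congr rfl fun i _ => ?_
    by_cases hi : i ∈ S
    · simp [hs i hi]
    · simp [restrict, hi, Matrix.one_apply]

theorem hasLightCone_op (L : SingleLayer m) (S : Finset (Fin m)) : HasLightCone S S L.op :=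
  ⟨subset_rfl, (L.restrict Sᶜ).op, op_mem_unitaryGroup _, (L.restrict S).op,
    op_mem_unitaryGroup _, L.supportedOn_restrict_op _, L.supportedOn_restrict_op _, by
    rw [← op_mul, restrict_compl_mul_restrict]⟩

end SingleLayer

theorem norm_czPhase (T : Finset (Fin m)) (z : Bits (Fin m)) : ‖czPhase T z‖ = 1 := by
  unfold czPhase
  split_ifs <;> simp

theorem dependsOn_czPhase (T : Finset (Fin m)) : DependsOn (czPhase T) (T : Set (Fin m)) := by
  intro z w h
  have : (∀ i ∈ T, z i = true) ↔ ∀ i ∈ T, w i = true :=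
    forall₂_congr fun i hi => by rw [h i hi]
  simp only [czPhase, this]

namespace CZLayer

variable (M : CZLayer m)

theorem op_mem_unitaryGroup : M.op ∈ Matrix.unitaryGroup (Bits (Fin m)) ℂ := by
  rw [Matrix.mem_unitaryGroup_iff', Matrix.star_eq_conjTranspose, CZLayer.op,
    Matrix.diagonal_conjTranspose, Matrix.diagonal_mul_diagonal, ← Matrix.diagonal_one]
  congr 1
  funext z
  rw [Pi.star_apply, RCLike.star_def, Complex.conj_mul', norm_prod]
  simp [norm_czPhase]

theorem supportedOn_op (h : ∀ T ∈ M.supports, T ⊆ S) : SupportedOn S M.op :=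
  supportedOn_diagonal fun _ _ hzw => Finset.prod_congr rfl fun T hT =>
    dependsOn_czPhase T fun i hi => hzw i (h T hT hi)

/-- The layer formed by the gates of `M` whose supports satisfy `p`. -/
def filter (p : Finset (Fin m) → Prop) [DecidablePred p] : CZLayer m where
  supports := M.supports.filter p
  interval T hT := M.interval T (Finset.mem_of_mem_filter T hT)
  disjoint T hT T' hT' := M.disjoint T (Finset.mem_of_mem_filter T hT) T'
    (Finset.mem_of_mem_filter T' hT')

theorem filter_op_mul_filter_not_op (p : Finset (Fin m) → Prop) [DecidablePred p] :
    (M.filter p).op * (M.filter fun T => ¬p T).op = M.op := by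
  simp only [CZLayer.op, filter, Matrix.diagonal_mul_diagonal,
    Finset.prod_filter_mul_prod_filter_not]

/-- The set `S` enlarged by the supports of the gates of `M` that meet it. -/
def spread (S : Finset (Fin m)) : Finset (Fin m) :=
  S ∪ (M.supports.filter fun T => ¬Disjoint T S).biUnion id

variable {M}

theorem subset_spread : S ⊆ M.spread S := Finset.subset_union_left

theorem subset_spread_of_mem (hT : T ∈ M.supports) (hTS : ¬Disjoint T S) : T ⊆ M.spread S :=
  (Finset.subset_biUnion_of_mem id (Finset.mem_filter.2 ⟨hT, hTS⟩)).trans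
    Finset.subset_union_right

theorem spread_subset_iff :
    M.spread S ⊆ T ↔ S ⊆ T ∧ ∀ R ∈ M.supports, ¬Disjoint R S → R ⊆ T := by
  simp only [spread, Finset.union_subset_iff, Finset.biUnion_subset, Finset.mem_filter,
    and_imp, id]

theorem mem_spread {i : Fin m} :
    i ∈ M.spread S ↔ i ∈ S ∨ ∃ T ∈ M.supports, ¬Disjoint T S ∧ i ∈ T := by
  simp [spread, and_assoc]

theorem spread_union (S T : Finset (Fin m)) : M.spread (S ∪ T) = M.spread S ∪ M.spread T := by
  ext i
  simp only [mem_spread, Finset.mem_union, Finset.disjoint_union_right]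
  grind

theorem hasLightCone_op (M : CZLayer m) (S : Finset (Fin m)) :
    HasLightCone S (M.spread S) M.op := by
  refine ⟨subset_spread, (M.filter fun T => Disjoint T S).op, op_mem_unitaryGroup _,
    (M.filter fun T => ¬Disjoint T S).op, op_mem_unitaryGroup _, supportedOn_op _ fun T hT => ?_,
    supportedOn_op _ fun T hT => ?_, (M.filter_op_mul_filter_not_op _).symm⟩
  · exact Finset.subset_compl_iff_disjoint_right.2 (Finset.mem_filter.1 hT).2
  · exact subset_spread_of_mem (Finset.mem_filter.1 hT).1 (Finset.mem_filter.1 hT).2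

end CZLayer

namespace Circuit

theorem op_mem_unitaryGroup (C : Circuit m d) :
    C.op ∈ Matrix.unitaryGroup (Bits (Fin m)) ℂ := by
  induction C with
  | base L => exact L.op_mem_unitaryGroup
  | step _ M L ih => exact mul_mem (mul_mem L.op_mem_unitaryGroup M.op_mem_unitaryGroup) ih

/-- The backward light cone of a set `S` of output qubits. -/
def backCone : {d : ℕ} → Circuit m d → Finset (Fin m) → Finset (Fin m)
  | _, .base _, S => S
  | _, .step C M _, S => C.backCone (M.spread S)

theorem hasLightCone_op (C : Circuit m d) (S : Finset (Fin m)) :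
    HasLightCone S (C.backCone S) C.op := by
  induction C generalizing S with
  | base L => exact L.hasLightCone_op S
  | step _ M L ih => exact ((L.hasLightCone_op S).mul (M.hasLightCone_op S)).mul (ih _)

theorem subset_backCone (C : Circuit m d) (S : Finset (Fin m)) : S ⊆ C.backCone S :=
  (C.hasLightCone_op S).subset

theorem backCone_union (C : Circuit m d) (S T : Finset (Fin m)) :
    C.backCone (S ∪ T) = C.backCone S ∪ C.backCone T := by
  induction C generalizing S T with
  | base _ => rfl
  | step _ _ _ ih => simp only [backCone, CZLayer.spread_union, ih]

theorem backCone_mono (C : Circuit m d) (h : S ⊆ T) : C.backCone S ⊆ C.backCone T := by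
  rw [← Finset.union_eq_right.2 h, C.backCone_union]
  exact Finset.subset_union_left

/-- The inputs among `I` whose forward light cones stay inside `T`. -/
def confined (C : Circuit m d) (I T : Finset (Fin m)) : Finset (Fin m) := I \ C.backCone Tᶜ

theorem confined_subset (C : Circuit m d) (I T : Finset (Fin m)) :
    C.confined I T ⊆ I ∩ T := by
  intro i hi
  rw [confined, Finset.mem_sdiff] at hi
  refine Finset.mem_inter.2 ⟨hi.1, ?_⟩
  by_contra hT
  exact hi.2 (C.subset_backCone _ (Finset.mem_compl.2 hT))

end Circuit

end Layers

section Unitary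

variable {κ : Type*} [Fintype κ] [DecidableEq κ] {U : Matrix κ κ ℂ}

theorem norm_toLp_mulVec_of_mem_unitaryGroup (hU : U ∈ Matrix.unitaryGroup κ ℂ) (ψ : κ → ℂ) :
    ‖toLp 2 (U.mulVec ψ)‖ = ‖toLp 2 ψ‖ := by
  rw [← Matrix.toEuclideanCLM_toLp]
  exact ContinuousLinearMap.norm_map_of_mem_unitary
    (Unitary.map_mem (Matrix.toEuclideanCLM (n := κ) (𝕜 := ℂ)) hU) _

theorem sum_norm_sq_col_of_mem_unitaryGroup (hU : U ∈ Matrix.unitaryGroup κ ℂ) (w : κ) :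
    ∑ z, ‖U z w‖ ^ 2 = 1 := by
  have h := norm_toLp_mulVec_of_mem_unitaryGroup hU (Pi.single w 1)
  rw [Matrix.mulVec_single_one, PiLp.toLp_single, PiLp.norm_single, norm_one,
    ← sq_eq_sq₀ (norm_nonneg _) zero_le_one, EuclideanSpace.norm_sq_eq, one_pow] at h
  exact h

theorem sum_norm_sq_row_of_mem_unitaryGroup (hU : U ∈ Matrix.unitaryGroup κ ℂ) (z : κ) :
    ∑ w, ‖U z w‖ ^ 2 = 1 := by
  simpa only [Matrix.star_apply, norm_star] using
    sum_norm_sq_col_of_mem_unitaryGroup (Unitary.star_mem hU) z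

end Unitary

section OutcomeProb

variable {V : Type*} [Fintype V] [DecidableEq V] {P T R : Finset V} {W X U : Op V}

/-- The probability that measuring the qubits of `T` in the state `φ` gives the bits of `b`. -/
noncomputable def outcomeProb (T : Finset V) (b : Bits V) (φ : Ket V) : ℝ :=
  ∑ z with ∀ i ∈ T, z i = b i, ‖φ z‖ ^ 2

theorem outcomeProb_nonneg (T : Finset V) (b : Bits V) (φ : Ket V) : 0 ≤ outcomeProb T b φ :=
  Finset.sum_nonneg fun _ _ => sq_nonneg _

theorem sum_outcomeProb_compl (T : Finset V) (b : Bits V) (φ : Ket V) :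
    ∑ u with ∀ i ∈ T, u i = b i, outcomeProb Tᶜ u φ = ∑ v, ‖φ v‖ ^ 2 := by
  have hmaps : ∀ v ∈ (Finset.univ : Finset (Bits V)),
      T.piecewise b v ∈ Finset.univ.filter fun u : Bits V => ∀ i ∈ T, u i = b i := by
    simp +contextual
  rw [← Finset.sum_fiberwise_of_maps_to hmaps]
  refine Finset.sum_congr rfl fun u hu => Finset.sum_congr (Finset.filter_congr fun v _ => ?_)
    fun _ _ => rfl
  rw [Finset.mem_filter] at hu
  simp only [funext_iff, Finset.piecewise, Finset.mem_compl]
  grind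

theorem SupportedOn.outcomeProb_row_congr (hW : SupportedOn T W) (hP : P ⊆ T) {b u : Bits V}
    (hu : ∀ i ∈ T, u i = b i) (z : Bits V) :
    outcomeProb P z (W.row u) = outcomeProb P z (W.row b) := by
  have hs : ∀ i ∈ T, (u ∆ b) i = false := fun i hi => by simp [hu i hi]
  unfold outcomeProb
  rw [Finset.sum_filter, Finset.sum_filter,
    ← Equiv.sum_comp (symmDiff_left_involutive (u ∆ b)).toPerm]
  refine Finset.sum_congr rfl fun v _ => ?_
  have hrow : W u (v ∆ (u ∆ b)) = W b v := by
    rw [← hW.apply_symmDiff hs b v, symmDiff_comm u b, symmDiff_symmDiff_cancel_left]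
  have hcond : (∀ i ∈ P, (v ∆ (u ∆ b)) i = z i) ↔ ∀ i ∈ P, v i = z i :=
    forall₂_congr fun i hi => by rw [Pi.symmDiff_apply, hs i (hP hi)]; simp
  simp only [Function.Involutive.coe_toPerm, Matrix.row_apply, hrow, hcond]

theorem SupportedOn.norm_mul_apply_sq_le (hW : SupportedOn T W) (hX : SupportedOn R X)
    (hP : Disjoint P R) (u z : Bits V) :
    ‖(W * X) u z‖ ^ 2 ≤ outcomeProb P z (W.row u) * outcomeProb Tᶜ u (X.col z) := by
  have hmem : ∀ v ∈ Finset.univ, W u v * X v z ≠ 0 →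
      (∀ i ∈ P, v i = z i) ∧ ∀ i ∈ Tᶜ, v i = u i := fun v _ h =>
    ⟨fun i hi => hX.eq_of_ne_zero (right_ne_zero_of_mul h) i (Finset.disjoint_left.1 hP hi),
      fun i hi => (hW.eq_of_ne_zero (left_ne_zero_of_mul h) i (Finset.mem_compl.1 hi)).symm⟩
  rw [Matrix.mul_apply, ← Finset.sum_filter_of_ne hmem]
  calc _ ≤ (∑ v with (∀ i ∈ P, v i = z i) ∧ ∀ i ∈ Tᶜ, v i = u i, ‖W u v‖ * ‖X v z‖) ^ 2 := by
        gcongr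
        exact norm_sum_le_of_le _ fun v _ => norm_mul_le _ _
    _ ≤ _ := Finset.sum_mul_sq_le_sq_mul_sq _ _ _
    _ ≤ _ := by
        refine mul_le_mul ?_ ?_ (Finset.sum_nonneg fun _ _ => sq_nonneg _)
          (outcomeProb_nonneg _ _ _)
        all_goals
          refine Finset.sum_le_sum_of_subset_of_nonneg (fun v => ?_) fun _ _ _ => sq_nonneg _
          simp +contextual

theorem HasLightCone.exists_outcomeProb_col_le (hU : HasLightCone Tᶜ R U) (b : Bits V) :
    ∃ φ : Ket V, IsUnitKet φ ∧ ∀ P, Disjoint P R → ∀ z,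
      outcomeProb T b (U.col z) ≤ outcomeProb P z φ := by
  obtain ⟨W, hW, X, hX, sW, sX, rfl⟩ := hU.exists_eq_mul
  rw [compl_compl] at sW
  refine ⟨W.row b, sum_norm_sq_row_of_mem_unitaryGroup hW b, fun P hP z => ?_⟩
  have hPT : P ⊆ T :=
    compl_le_compl_iff_le.1 (hU.subset.trans (Finset.subset_compl_iff_disjoint_left.2 hP))
  calc outcomeProb T b ((W * X).col z)
      ≤ ∑ u with ∀ i ∈ T, u i = b i, outcomeProb P z (W.row b) * outcomeProb Tᶜ u (X.col z) :=
        Finset.sum_le_sum fun u hu => by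
          rw [← sW.outcomeProb_row_congr hPT (Finset.mem_filter.1 hu).2]
          exact sW.norm_mul_apply_sq_le sX hP u z
    _ = outcomeProb P z (W.row b) := by
        have hcol : ∑ v, ‖X.col z v‖ ^ 2 = 1 := sum_norm_sq_col_of_mem_unitaryGroup hX z
        rw [← Finset.mul_sum, sum_outcomeProb_compl, hcol, mul_one]

end OutcomeProb

section RandomInputs

theorem expect_ite_forall_mem_eq {ι : Type*} [Fintype ι] [DecidableEq ι] (Q : Finset ι)
    (b : Bits ι) (c : ℝ) :
    𝔼 x : Bits ι, (if ∀ i ∈ Q, b i = x i then c else 0) = c / 2 ^ Q.card := by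
  have hset : (Finset.univ.filter fun x : Bits ι => ∀ i ∈ Q, b i = x i) =
      Fintype.piFinset (Q.piecewise (fun i => {b i}) fun _ => Finset.univ) := by
    ext x
    simp only [Finset.mem_filter, Finset.mem_univ, true_and, Fintype.mem_piFinset]
    refine forall_congr' fun i => ?_
    by_cases hi : i ∈ Q
    · simpa [hi] using eq_comm
    · simp [hi]
  have hcard : (Finset.univ.filter fun x : Bits ι => ∀ i ∈ Q, b i = x i).card * 2 ^ Q.card =
      2 ^ Fintype.card ι := by
    rw [hset, Fintype.card_piFinset, ← Finset.card_compl_add_card Q, pow_add]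
    simp [Finset.piecewise, apply_ite Finset.card, Finset.prod_ite, Finset.filter_notMem_eq_sdiff,
      Finset.compl_eq_univ_sdiff]
  rw [Fintype.expect_eq_sum_div_card, ← Finset.sum_filter, Finset.sum_const, nsmul_eq_mul,
    Fintype.card_fun, Fintype.card_bool, div_eq_div_iff (by positivity) (by positivity), ← hcard]
  push_cast
  ring

variable {m d : ℕ} {I P : Finset (Fin m)}

theorem expect_eq (f : Bits I → ℝ) : expect I f = 𝔼 x, f x := by
  simp [expect, Fintype.expect_eq_sum_div_card]

theorem eq_join_iff {z : Bits (Fin m)} {x : Bits I} {a : Bits (Anc I)} :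
    z = join I x a ↔ (fun i : I => z i) = x ∧ (fun i : Anc I => z i) = a :=
  ((Equiv.piEquivPiSubtypeProd (· ∈ I) fun _ => Bool).eq_symm_apply (y := z)
    (x := (x, a))).trans Prod.ext_iff

theorem join_input (x : Bits I) (a : Bits (Anc I)) : (fun i : I => join I x a i) = x :=
  (eq_join_iff.1 rfl).1

theorem join_anc (x : Bits I) (a : Bits (Anc I)) : (fun i : Anc I => join I x a i) = a :=
  (eq_join_iff.1 rfl).2

theorem tensor_basisKet (x : Bits I) (a : Bits (Anc I)) :
    tensor I (basisKet x) (basisKet a) = Pi.single (join I x a) 1 := by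
  funext z
  simp [tensor, basisKet, Pi.single_apply, eq_join_iff, ← ite_and, and_comm]

theorem expect_outcomeProb_join (hP : P ⊆ I) (a : Bits (Anc I)) (φ : Ket (Fin m)) :
    𝔼 x : Bits I, outcomeProb P (join I x a) φ = (∑ z, ‖φ z‖ ^ 2) / 2 ^ P.card := by
  have hcard : (P.subtype (· ∈ I)).card = P.card := by
    rw [Finset.card_subtype, Finset.filter_true_of_mem hP]
  have hite : ∀ (z : Bits (Fin m)) (x : Bits I), (∀ i ∈ P, z i = join I x a i) ↔
      ∀ i ∈ P.subtype (· ∈ I), z i = x i := fun z x => by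
    simp only [Finset.mem_subtype, Subtype.forall]
    exact ⟨fun h i hI hi => by simpa [join, hI] using h i hi,
      fun h i hi => by simpa [join, hP hi] using h i (hP hi) hi⟩
  simp only [outcomeProb, Finset.sum_filter, hite]
  rw [Finset.expect_sum_comm, Finset.sum_div, ← hcard]
  exact Finset.sum_congr rfl fun z _ => expect_ite_forall_mem_eq _ (fun i : I => z i) _

namespace Circuit

theorem output_eq_col (C : Circuit m d) (I : Finset (Fin m)) (x : Bits I) :
    C.output I x = C.op.col (join I x fun _ => false) := by
  rw [Circuit.output, tensor_basisKet, Matrix.mulVec_single_one]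

theorem isUnitKet_output (C : Circuit m d) (I : Finset (Fin m)) (x : Bits I) :
    IsUnitKet (C.output I x) := by
  rw [output_eq_col]
  exact sum_norm_sq_col_of_mem_unitaryGroup C.op_mem_unitaryGroup _

/-- A measurement on `T` must reproduce the inputs whose light cones it swallows, hence sees any
given outcome rarely when there are many of them. -/
theorem expect_outcomeProb_output_le (C : Circuit m d) (I T : Finset (Fin m))
    (b : Bits (Fin m)) :
    𝔼 x : Bits I, outcomeProb T b (C.output I x) ≤ 1 / 2 ^ (C.confined I T).card := by
  obtain ⟨φ, hφ, hle⟩ := (C.hasLightCone_op Tᶜ).exists_outcomeProb_col_le b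
  calc 𝔼 x : Bits I, outcomeProb T b (C.output I x)
      ≤ 𝔼 x : Bits I, outcomeProb (C.confined I T) (join I x fun _ => false) φ :=
        Finset.expect_le_expect fun x _ => by
          rw [output_eq_col]
          exact hle _ Finset.sdiff_disjoint _
    _ = 1 / 2 ^ (C.confined I T).card := by
        rw [expect_outcomeProb_join ((C.confined_subset I T).trans Finset.inter_subset_left),
          show ∑ z, ‖φ z‖ ^ 2 = 1 from hφ]

end Circuit

end RandomInputs

section Pruning

variable {m d : ℕ} {I : Finset (Fin m)} {τ : ℕ}

theorem norm_prod_czPhase_sub_one_sq_le (s : Finset (Finset (Fin m))) (z : Bits (Fin m)) :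
    ‖∏ T ∈ s, czPhase T z - 1‖ ^ 2 ≤ 4 * (s.filter fun T => ∀ i ∈ T, z i = true).card := by
  rcases (s.filter fun T => ∀ i ∈ T, z i = true).eq_empty_or_nonempty with h | h
  · have hone : ∏ T ∈ s, czPhase T z = 1 :=
      Finset.prod_eq_one fun T hT => if_neg (Finset.filter_eq_empty_iff.1 h hT)
    simp [hone]
  · have hcard : (1 : ℝ) ≤ (s.filter fun T => ∀ i ∈ T, z i = true).card := by
      exact_mod_cast h.card_pos
    have hnorm : ‖∏ T ∈ s, czPhase T z - 1‖ ≤ 2 := by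
      refine (norm_sub_le _ _).trans_eq ?_
      rw [norm_prod]
      norm_num [norm_czPhase]
    nlinarith [norm_nonneg (∏ T ∈ s, czPhase T z - 1)]

namespace CZLayer

variable (M : CZLayer m) (p : Finset (Fin m) → Prop) [DecidablePred p]

theorem norm_op_mulVec_sub_filter_op_mulVec_sq_le (φ : Ket (Fin m)) :
    ‖toLp 2 (M.op.mulVec φ - (M.filter p).op.mulVec φ)‖ ^ 2 ≤
      4 * ∑ T ∈ M.supports with ¬p T, outcomeProb T (fun _ => true) φ := by
  have hentry (z : Bits (Fin m)) : ‖(M.op.mulVec φ - (M.filter p).op.mulVec φ) z‖ ^ 2 =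
      ‖∏ T ∈ M.supports with ¬p T, czPhase T z - 1‖ ^ 2 * ‖φ z‖ ^ 2 := by
    have hfilter : ‖∏ T ∈ (M.filter p).supports, czPhase T z‖ = 1 := by
      simp [norm_prod, norm_czPhase]
    rw [← M.filter_op_mul_filter_not_op p, ← Matrix.mulVec_mulVec, ← Matrix.mulVec_sub,
      CZLayer.op, Matrix.mulVec_diagonal, norm_mul, hfilter, one_mul, Pi.sub_apply, CZLayer.op,
      Matrix.mulVec_diagonal, ← sub_one_mul, norm_mul, mul_pow, filter]
  simp only [EuclideanSpace.norm_sq_eq, hentry, outcomeProb]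
  rw [Finset.sum_comm' (t' := Finset.univ)
    (s' := fun z => (M.supports.filter fun T => ¬p T).filter fun T => ∀ i ∈ T, z i = true)
    (by simp), Finset.mul_sum]
  refine Finset.sum_le_sum fun z _ => ?_
  rw [Finset.sum_const, nsmul_eq_mul, ← mul_assoc]
  exact mul_le_mul_of_nonneg_right (norm_prod_czPhase_sub_one_sq_le _ z) (sq_nonneg _)

theorem card_filter_supports_le (h : ∀ T, p T → (I ∩ T).Nonempty) :
    (M.supports.filter p).card ≤ I.card := by
  calc (M.supports.filter p).card
      ≤ ∑ T ∈ M.supports.filter p, (I ∩ T).card := by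
        rw [Finset.card_eq_sum_ones]
        exact Finset.sum_le_sum fun T hT => (h T (Finset.mem_filter.1 hT).2).card_pos
    _ = ((M.supports.filter p).biUnion fun T => I ∩ T).card :=
        (Finset.card_biUnion fun T hT T' hT' hne =>
          (M.disjoint T (Finset.mem_of_mem_filter T hT) T' (Finset.mem_of_mem_filter T' hT')
            hne).mono Finset.inter_subset_right Finset.inter_subset_right).symm
    _ ≤ I.card := Finset.card_le_card (Finset.biUnion_subset.2 fun _ _ => Finset.inter_subset_left)

end CZLayer

theorem sq_expect_le_expect_sq {ι : Type*} [Fintype ι] (f : ι → ℝ) :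
    (𝔼 i, f i) ^ 2 ≤ 𝔼 i, f i ^ 2 := by
  rcases isEmpty_or_nonempty ι with _ | _
  · simp
  · simpa using Finset.expect_mul_sq_le_sq_mul_sq Finset.univ f 1

namespace Circuit

/-- The circuit obtained from `C` by deleting the `CZ` gates that confine at least `τ` of the
inputs `I`, where the light cones are those of the part of the circuit that is already pruned. -/
def prune (I : Finset (Fin m)) (τ : ℕ) : {d : ℕ} → Circuit m d → Circuit m d
  | _, .base L => .base L
  | _, .step C M L =>
    .step (C.prune I τ) (M.filter fun T => ((C.prune I τ).confined I T).card < τ) L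

theorem expect_norm_layer_sub_le (C : Circuit m d) (M : CZLayer m) (hτ : 0 < τ) :
    𝔼 x : Bits I, ‖toLp 2 (M.op.mulVec (C.output I x) -
      (M.filter fun T => (C.confined I T).card < τ).op.mulVec (C.output I x))‖ ≤
      2 * √(I.card / 2 ^ τ) := by
  have hsqrt : 2 * √(I.card / 2 ^ τ : ℝ) = √(4 * (I.card / 2 ^ τ)) := by
    rw [Real.sqrt_mul zero_le_four, show (4 : ℝ) = 2 ^ 2 by norm_num, Real.sqrt_sq zero_le_two]
  have hcard : (M.supports.filter fun T => ¬(C.confined I T).card < τ).card ≤ I.card :=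
    M.card_filter_supports_le _ fun T hT =>
      (Finset.card_pos.1 (hτ.trans_le (not_lt.1 hT))).mono (C.confined_subset I T)
  rw [hsqrt]
  refine Real.le_sqrt_of_sq_le ((sq_expect_le_expect_sq _).trans ?_)
  calc _ ≤ 𝔼 x : Bits I, 4 * ∑ T ∈ M.supports with ¬(C.confined I T).card < τ,
        outcomeProb T (fun _ => true) (C.output I x) :=
        Finset.expect_le_expect fun x _ => M.norm_op_mulVec_sub_filter_op_mulVec_sq_le _ _
    _ = 4 * ∑ T ∈ M.supports with ¬(C.confined I T).card < τ,
        𝔼 x : Bits I, outcomeProb T (fun _ => true) (C.output I x) := by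
        rw [← Finset.mul_expect, Finset.expect_sum_comm]
    _ ≤ 4 * ∑ T ∈ M.supports with ¬(C.confined I T).card < τ, 1 / 2 ^ τ := by
        gcongr with T hT
        refine (C.expect_outcomeProb_output_le I T _).trans ?_
        gcongr
        · exact one_le_two
        · exact not_lt.1 (Finset.mem_filter.1 hT).2
    _ ≤ 4 * (I.card / 2 ^ τ) := by
        rw [Finset.sum_const, nsmul_eq_mul, mul_one_div]
        gcongr

theorem output_step (C : Circuit m d) (M : CZLayer m) (L : SingleLayer m) (x : Bits I) :
    (Circuit.step C M L).output I x = L.op.mulVec (M.op.mulVec (C.output I x)) := by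
  simp only [Circuit.output, Circuit.op, Matrix.mulVec_mulVec, mul_assoc]

theorem norm_output_step_sub_le (C C' : Circuit m d) (M M' : CZLayer m) (L : SingleLayer m)
    (x : Bits I) :
    ‖toLp 2 ((Circuit.step C M L).output I x - (Circuit.step C' M' L).output I x)‖ ≤
      ‖toLp 2 (C.output I x - C'.output I x)‖ +
        ‖toLp 2 (M.op.mulVec (C'.output I x) - M'.op.mulVec (C'.output I x))‖ := by
  rw [output_step, output_step, ← Matrix.mulVec_sub,
    norm_toLp_mulVec_of_mem_unitaryGroup L.op_mem_unitaryGroup,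
    ← norm_toLp_mulVec_of_mem_unitaryGroup M.op_mem_unitaryGroup (C.output I x - C'.output I x),
    Matrix.mulVec_sub]
  simp only [WithLp.toLp_sub]
  exact norm_sub_le_norm_sub_add_norm_sub _ _ _

theorem expect_norm_output_sub_prune_le (C : Circuit m d) (I : Finset (Fin m)) (hτ : 0 < τ) :
    𝔼 x : Bits I, ‖toLp 2 (C.output I x - (C.prune I τ).output I x)‖ ≤
      d * (2 * √(I.card / 2 ^ τ)) := by
  induction C with
  | base L => simp [prune]
  | step C M L ih =>
    refine (Finset.expect_le_expect fun x _ => norm_output_step_sub_le _ _ _ _ _ x).trans ?_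
    rw [Finset.expect_add_distrib, Nat.cast_add_one, add_one_mul]
    exact add_le_add ih (expect_norm_layer_sub_le _ M hτ)

end Circuit

end Pruning

section Cuts

variable {m d : ℕ} {I S D : Finset (Fin m)} {τ : ℕ} {a b : Fin m}

namespace CZLayer

variable {M : CZLayer m}

theorem ordConnected_of_mem {T : Finset (Fin m)} (hT : T ∈ M.supports) :
    (T : Set (Fin m)).OrdConnected := by
  obtain ⟨a, b, -, rfl⟩ := M.interval T hT
  rw [Finset.coe_Icc]
  exact Set.ordConnected_Icc

theorem spread_subset_Iic (hab : a ≤ b) (hT : Finset.Icc a b ∈ M.supports)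
    (hS : S ⊆ Finset.Iic b) : M.spread S ⊆ Finset.Iic b := by
  refine spread_subset_iff.2 ⟨hS, fun R hR hRS i hi => ?_⟩
  obtain ⟨r, hrR, hrS⟩ := Finset.not_disjoint_iff.1 hRS
  rw [Finset.mem_Iic]
  by_contra! hbi
  have hbR : b ∈ R := (ordConnected_of_mem hR).out hrR hi ⟨Finset.mem_Iic.1 (hS hrS), hbi.le⟩
  have hRT : R = Finset.Icc a b := by
    by_contra hne
    exact Finset.disjoint_left.1 (M.disjoint R hR _ hT hne) hbR (Finset.right_mem_Icc.2 hab)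
  exact hbi.not_ge (Finset.mem_Icc.1 (hRT ▸ hi)).2

theorem spread_subset_Ici (hab : a ≤ b) (hT : Finset.Icc a b ∈ M.supports)
    (hS : S ⊆ Finset.Ici a) : M.spread S ⊆ Finset.Ici a := by
  refine spread_subset_iff.2 ⟨hS, fun R hR hRS i hi => ?_⟩
  obtain ⟨r, hrR, hrS⟩ := Finset.not_disjoint_iff.1 hRS
  rw [Finset.mem_Ici]
  by_contra! hia
  have haR : a ∈ R := (ordConnected_of_mem hR).out hi hrR ⟨hia.le, Finset.mem_Ici.1 (hS hrS)⟩
  have hRT : R = Finset.Icc a b := by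
    by_contra hne
    exact Finset.disjoint_left.1 (M.disjoint R hR _ hT hne) haR (Finset.left_mem_Icc.2 hab)
  exact hia.not_ge (Finset.mem_Icc.1 (hRT ▸ hi)).1

theorem ordConnected_spread (hS : (S : Set (Fin m)).OrdConnected) :
    (M.spread S : Set (Fin m)).OrdConnected := by
  have exists_uIcc_subset : ∀ i ∈ M.spread S, ∃ p ∈ S, Set.uIcc i p ⊆ M.spread S := by
    intro i hi
    rcases mem_spread.1 hi with hiS | ⟨T, hT, hTS, hiT⟩
    · exact ⟨i, hiS, by simpa using hi⟩
    · obtain ⟨p, hpT, hpS⟩ := Finset.not_disjoint_iff.1 hTS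
      exact ⟨p, hpS, ((ordConnected_of_mem hT).uIcc_subset hiT hpT).trans
        (Finset.coe_subset.2 (subset_spread_of_mem hT hTS))⟩
  rw [Set.ordConnected_iff_uIcc_subset]
  intro i hi j hj
  obtain ⟨p, hp, hip⟩ := exists_uIcc_subset i hi
  obtain ⟨q, hq, hjq⟩ := exists_uIcc_subset j hj
  have hpq : Set.uIcc p q ⊆ M.spread S :=
    (hS.uIcc_subset hp hq).trans (Finset.coe_subset.2 subset_spread)
  calc Set.uIcc i j ⊆ Set.uIcc i p ∪ Set.uIcc p j := Set.uIcc_subset_uIcc_union_uIcc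
    _ ⊆ Set.uIcc i p ∪ (Set.uIcc p q ∪ Set.uIcc q j) :=
        Set.union_subset_union_right _ Set.uIcc_subset_uIcc_union_uIcc
    _ ⊆ M.spread S := Set.union_subset hip (Set.union_subset hpq (by rwa [Set.uIcc_comm]))

end CZLayer

namespace Circuit

theorem ordConnected_backCone (C : Circuit m d) (hS : (S : Set (Fin m)).OrdConnected) :
    (C.backCone S : Set (Fin m)).OrdConnected := by
  induction C generalizing S with
  | base _ => exact hS
  | step _ _ _ ih => exact ih (CZLayer.ordConnected_spread hS)

/-- The inputs among `I` whose forward light cones meet both sides of the cut that separates `D`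
from its complement. -/
def crossing (C : Circuit m d) (I D : Finset (Fin m)) : Finset (Fin m) :=
  I ∩ (C.backCone D ∩ C.backCone Dᶜ)

theorem card_inter_backCone_Iic_inter_backCone_Ici_le (C : Circuit m d) (I : Finset (Fin m))
    (a b : Fin m) :
    (I ∩ (C.backCone (Finset.Iic b) ∩ C.backCone (Finset.Ici a))).card ≤
      (C.confined I (Finset.Icc a b)).card + (C.crossing I (Finset.Iio a)).card +
        (C.crossing I (Finset.Iic b)).card := by
  have hIcc : (Finset.Icc a b)ᶜ = Finset.Iio a ∪ (Finset.Iic b)ᶜ := by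
    ext i
    simp only [Finset.mem_compl, Finset.mem_Icc, Finset.mem_union, Finset.mem_Iio, Finset.mem_Iic]
    grind
  have hIio : (Finset.Iio a)ᶜ = Finset.Ici a := by
    ext i
    simp
  refine (Finset.card_le_card (t := (C.confined I (Finset.Icc a b) ∪
    C.crossing I (Finset.Iio a)) ∪ C.crossing I (Finset.Iic b)) fun q hq => ?_).trans
    ((Finset.card_union_le _ _).trans (Nat.add_le_add_right (Finset.card_union_le _ _) _))
  simp only [confined, crossing, hIcc, hIio, C.backCone_union, Finset.mem_union,
    Finset.mem_inter, Finset.mem_sdiff] at hq ⊢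
  tauto

theorem crossing_step_subset_or (C : Circuit m d) (M : CZLayer m) (L : SingleLayer m)
    (I : Finset (Fin m)) (hD : IsLowerSet (D : Set (Fin m))) :
    (C.step M L).crossing I D ⊆ C.crossing I D ∨ ∃ a b, Finset.Icc a b ∈ M.supports ∧
      (C.step M L).crossing I D ⊆ I ∩ (C.backCone (Finset.Iic b) ∩ C.backCone (Finset.Ici a)) := by
  have crossing_subset {R R' : Finset (Fin m)} (h : M.spread D ⊆ R) (h' : M.spread Dᶜ ⊆ R') :
      (C.step M L).crossing I D ⊆ I ∩ (C.backCone R ∩ C.backCone R') :=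
    Finset.inter_subset_inter_left
      (Finset.inter_subset_inter (C.backCone_mono h) (C.backCone_mono h'))
  by_cases hcross : ∃ T ∈ M.supports, ¬Disjoint T D ∧ ¬Disjoint T Dᶜ
  · obtain ⟨T, hT, hTD, hTD'⟩ := hcross
    obtain ⟨a, b, hab, rfl⟩ := M.interval T hT
    obtain ⟨p, hp, hpD⟩ := Finset.not_disjoint_iff.1 hTD
    obtain ⟨q, hq, hqD⟩ := Finset.not_disjoint_iff.1 hTD'
    rw [Finset.mem_compl] at hqD
    rw [Finset.mem_Icc] at hp hq
    have hDb : D ⊆ Finset.Iic b := fun i hi => Finset.mem_Iic.2 <| by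
      by_contra! hbi
      exact hqD (hD (hq.2.trans hbi.le) hi)
    have hDa : Dᶜ ⊆ Finset.Ici a := fun i hi => Finset.mem_Ici.2 <| by
      by_contra! hia
      exact Finset.mem_compl.1 hi (hD (hia.le.trans hp.1) hpD)
    exact .inr ⟨a, b, hT, crossing_subset (CZLayer.spread_subset_Iic hab hT hDb)
      (CZLayer.spread_subset_Ici hab hT hDa)⟩
  · push Not at hcross
    refine .inl (crossing_subset (CZLayer.spread_subset_iff.2 ⟨subset_rfl, fun T hT h => ?_⟩)
      (CZLayer.spread_subset_iff.2 ⟨subset_rfl, fun T hT h => ?_⟩))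
    · exact disjoint_compl_right_iff.1 (hcross T hT h)
    · exact Finset.subset_compl_iff_disjoint_right.2 (by_contra fun h' => h (hcross T hT h'))

/-- A gate that remains across the cut confines fewer than `τ` inputs, and keeps all the other
gates of its layer from crossing the cut: the inputs that cross the cut are confined by that gate
or cross the line at one of its two ends. -/
theorem card_crossing_prune_add_le (C : Circuit m d) (I : Finset (Fin m)) (τ : ℕ)
    (hD : IsLowerSet (D : Set (Fin m))) :
    ((C.prune I τ).crossing I D).card + τ ≤ 2 ^ d * τ := by
  induction C generalizing D with
  | base L => simp [crossing, prune, backCone]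
  | @step d C M L ih =>
    rw [pow_succ]
    rcases (C.prune I τ).crossing_step_subset_or _ L I hD with hsub | ⟨a, b, hT, hsub⟩
    · have hD := ih hD
      have hcard := Finset.card_le_card hsub
      rw [prune]
      linarith
    · have hcard := (Finset.card_le_card hsub).trans
        ((C.prune I τ).card_inter_backCone_Iic_inter_backCone_Ici_le I a b)
      have hconf := (Finset.mem_filter.1 hT).2
      have ha := ih (D := Finset.Iio a) (by simpa using isLowerSet_Iio a)
      have hb := ih (D := Finset.Iic b) (by simpa using isLowerSet_Iic b)
      rw [prune]
      linarith

theorem card_inter_backCone_prune_singleton_le (C : Circuit m d) (I : Finset (Fin m))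
    (hτ : 0 < τ) (i : Fin m) :
    (I ∩ (C.prune I τ).backCone {i}).card ≤ 2 ^ (d + 1) * τ := by
  have hcone : (I ∩ (C.prune I τ).backCone {i}).card ≤ _ :=
    (Finset.card_le_card (Finset.inter_subset_inter_left (Finset.subset_inter
      (backCone_mono _ (by simp)) (backCone_mono _ (by simp))))).trans
      ((C.prune I τ).card_inter_backCone_Iic_inter_backCone_Ici_le I i i)
  have hconf : ((C.prune I τ).confined I (Finset.Icc i i)).card ≤ 1 := by
    rw [Finset.Icc_self, ← Finset.card_singleton i]
    exact Finset.card_le_card ((confined_subset _ I {i}).trans Finset.inter_subset_right)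
  have hIio := C.card_crossing_prune_add_le I τ (D := Finset.Iio i)
    (by simpa using isLowerSet_Iio i)
  have hIic := C.card_crossing_prune_add_le I τ (D := Finset.Iic i)
    (by simpa using isLowerSet_Iic i)
  rw [pow_succ]
  linarith

theorem exists_disjoint_backCone_prune (C : Circuit m d) (hτ : 0 < τ)
    (hI : 2 ^ (d + 2) * τ < I.card) :
    ∃ i ∈ I, ∃ j ∈ I, Disjoint ((C.prune I τ).backCone {i}) ((C.prune I τ).backCone {j}) := by
  have hne : I.Nonempty := Finset.card_pos.1 (by omega)
  refine ⟨I.min' hne, I.min'_mem hne, I.max' hne, I.max'_mem hne, ?_⟩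
  by_contra hmeet
  obtain ⟨q, hq, hq'⟩ := Finset.not_disjoint_iff.1 hmeet
  have hconn (i : Fin m) : ((C.prune I τ).backCone {i} : Set (Fin m)).OrdConnected :=
    ordConnected_backCone _ (by simpa using Set.ordConnected_singleton)
  have hcover : I ⊆ I ∩ (C.prune I τ).backCone {I.min' hne} ∪
      I ∩ (C.prune I τ).backCone {I.max' hne} := fun p hp => by
    rw [← Finset.inter_union_distrib_left, Finset.mem_inter, Finset.mem_union]
    refine ⟨hp, (le_total p q).imp (fun h => ?_) fun h => ?_⟩
    · exact (hconn _).out (subset_backCone _ _ (Finset.mem_singleton_self _)) hq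
        ⟨I.min'_le p hp, h⟩
    · exact (hconn _).out hq' (subset_backCone _ _ (Finset.mem_singleton_self _))
        ⟨h, I.le_max' p hp⟩
  have hcard := (Finset.card_le_card hcover).trans (Finset.card_union_le _ _)
  have hmin := C.card_inter_backCone_prune_singleton_le I hτ (I.min' hne)
  have hmax := C.card_inter_backCone_prune_singleton_le I hτ (I.max' hne)
  rw [pow_succ] at hI
  linarith

end Circuit

end Cuts

section Means

variable {V : Type*} [Fintype V] {S T P Q : Finset V} {f g : Bits V → ℝ}

/-- The mean value of the diagonal observable `f` in the state `φ`. -/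
noncomputable def mean [DecidableEq V] (φ : Ket V) (f : Bits V → ℝ) : ℝ := ∑ z, f z * ‖φ z‖ ^ 2

theorem abs_mean_sub_mean_le [DecidableEq V] {ψ φ : Ket V} (hψ : IsUnitKet ψ) (hφ : IsUnitKet φ)
    (hf : ∀ z, |f z| ≤ 1) : |mean ψ f - mean φ f| ≤ 2 * ‖toLp 2 (ψ - φ)‖ := by
  have cauchy_schwarz {χ : Ket V} (hχ : IsUnitKet χ) :
      ∑ z, ‖(ψ - φ) z‖ * ‖χ z‖ ≤ ‖toLp 2 (ψ - φ)‖ := by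
    refine (Real.sum_mul_le_sqrt_mul_sqrt _ _ _).trans_eq ?_
    rw [show ∑ z, ‖χ z‖ ^ 2 = 1 from hχ, Real.sqrt_one, mul_one, EuclideanSpace.norm_eq]
  have hterm (z : Bits V) : |f z * ‖ψ z‖ ^ 2 - f z * ‖φ z‖ ^ 2| ≤
      ‖(ψ - φ) z‖ * ‖ψ z‖ + ‖(ψ - φ) z‖ * ‖φ z‖ :=
    calc |f z * ‖ψ z‖ ^ 2 - f z * ‖φ z‖ ^ 2|
        = |f z| * (|‖ψ z‖ - ‖φ z‖| * (‖ψ z‖ + ‖φ z‖)) := by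
          rw [← mul_sub, abs_mul, sq_sub_sq, abs_mul, mul_comm |‖ψ z‖ + ‖φ z‖|,
            abs_of_nonneg (add_nonneg (norm_nonneg (ψ z)) (norm_nonneg (φ z)))]
      _ ≤ 1 * (‖(ψ - φ) z‖ * (‖ψ z‖ + ‖φ z‖)) := by
          gcongr
          · exact hf z
          · exact abs_norm_sub_norm_le _ _
      _ = _ := by ring
  calc |mean ψ f - mean φ f| = |∑ z, (f z * ‖ψ z‖ ^ 2 - f z * ‖φ z‖ ^ 2)| := by
        rw [mean, mean, Finset.sum_sub_distrib]
    _ ≤ ∑ z, (‖(ψ - φ) z‖ * ‖ψ z‖ + ‖(ψ - φ) z‖ * ‖φ z‖) :=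
        (Finset.abs_sum_le_sum_abs _ _).trans (Finset.sum_le_sum fun z _ => hterm z)
    _ ≤ 2 * ‖toLp 2 (ψ - φ)‖ := by
        rw [Finset.sum_add_distrib]
        linarith [cauchy_schwarz hψ, cauchy_schwarz hφ]

variable [DecidableEq V] {U : Op V}

theorem star_mul_diagonal_mul_apply_self (U : Op V) (f : Bits V → ℝ) (z : Bits V) :
    (star U * Matrix.diagonal (fun u => (f u : ℂ)) * U) z z = mean (U.col z) f := by
  rw [Matrix.mul_apply, mean, Complex.ofReal_sum]
  refine Finset.sum_congr rfl fun u _ => ?_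
  rw [Matrix.mul_diagonal, Matrix.star_apply, Matrix.col_apply, Complex.ofReal_mul,
    Complex.ofReal_pow, ← Complex.conj_mul', RCLike.star_def]
  ring

/-- In the Heisenberg picture the two observables act on disjoint sets of qubits. -/
theorem HasLightCone.mean_col_mul (hS : HasLightCone S P U) (hT : HasLightCone T Q U)
    (hPQ : Disjoint P Q) (hf : DependsOn f (S : Set V)) (hg : DependsOn g (T : Set V))
    (z : Bits V) : mean (U.col z) (f * g) = mean (U.col z) f * mean (U.col z) g := by
  have hU : U * star U = 1 := by
    obtain ⟨W, hW, X, hX, -, -, rfl⟩ := hS.exists_eq_mul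
    exact Matrix.mem_unitaryGroup_iff.1 (mul_mem hW hX)
  let Z (f : Bits V → ℝ) : Op V := Matrix.diagonal fun u => (f u : ℂ)
  have hZ {R : Finset V} {f : Bits V → ℝ} (hf : DependsOn f (R : Set V)) : SupportedOn R (Z f) :=
    supportedOn_diagonal fun z w h => congrArg Complex.ofReal (hf h)
  have hZmul : Z (f * g) = Z f * Z g := by simp [Z, Matrix.diagonal_mul_diagonal]
  have hconj : star U * Z (f * g) * U = (star U * Z f * U) * (star U * Z g * U) :=
    calc star U * Z (f * g) * U = star U * (Z f * (U * star U) * Z g) * U := by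
          rw [hU, mul_one, hZmul]
      _ = (star U * Z f * U) * (star U * Z g * U) := by simp only [mul_assoc]
  have hentry := congrFun (congrFun hconj z) z
  rw [(hS.supportedOn_star_mul_mul (hZ hf)).mul_apply_self_of_disjoint
    (hT.supportedOn_star_mul_mul (hZ hg)) hPQ] at hentry
  simp only [Z, star_mul_diagonal_mul_apply_self] at hentry
  exact_mod_cast hentry

/-- The eigenvalue of the Pauli operator `Z` at a bit. -/
def sign (b : Bool) : ℝ := if b then -1 else 1

theorem sign_not (b : Bool) : sign (!b) = -sign b := by cases b <;> simp [sign]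

theorem abs_sign (b : Bool) : |sign b| = 1 := by cases b <;> simp [sign]

theorem Circuit.mean_output_sign_mul_sign {m d : ℕ} (C : Circuit m d) {i j : Fin m}
    (h : Disjoint (C.backCone {i}) (C.backCone {j})) (I : Finset (Fin m)) (x : Bits I) :
    mean (C.output I x) (fun z => sign (z i) * sign (z j)) =
      mean (C.output I x) (fun z => sign (z i)) * mean (C.output I x) fun z => sign (z j) := by
  have hdep (k : Fin m) : DependsOn (fun z : Bits (Fin m) => sign (z k)) ({k} : Finset (Fin m)) :=
    fun z w hzw => congrArg sign (hzw k (by simp))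
  rw [output_eq_col]
  exact (C.hasLightCone_op {i}).mean_col_mul (C.hasLightCone_op {j}) h (hdep i) (hdep j) _

end Means

section TraceNorm

theorem trace_eq_sum_inner_mulVec {κ : Type*} [Fintype κ] (M : Matrix κ κ ℂ)
    (v : OrthonormalBasis κ ℂ (EuclideanSpace ℂ κ)) :
    M.trace = ∑ k, inner ℂ (v k) (toLp 2 (M.mulVec (v k))) := by
  classical
  rw [← Matrix.trace_toLin_eq M (EuclideanSpace.basisFun κ ℂ).toBasis,
    ← Matrix.toEuclideanLin_eq_toLin_orthonormal, LinearMap.trace_eq_sum_inner _ v]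
  rfl

open scoped Matrix.Norms.L2Operator

variable {κ : Type*} [Fintype κ] [DecidableEq κ]

theorem traceNorm_nonneg (M : Matrix κ κ ℂ) : 0 ≤ traceNorm M :=
  Finset.sum_nonneg fun _ _ => Real.sqrt_nonneg _

theorem norm_toLp_mulVec_eigenvectorBasis (M : Matrix κ κ ℂ) (k : κ) :
    ‖toLp 2 (M.mulVec ((Matrix.isHermitian_conjTranspose_mul_self M).eigenvectorBasis k))‖ =
      √((Matrix.isHermitian_conjTranspose_mul_self M).eigenvalues k) := by
  rw [Matrix.IsHermitian.eigenvalues_eq, ← Matrix.mulVec_mulVec, Matrix.dotProduct_mulVec,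
    ← Matrix.star_mulVec, dotProduct_comm, EuclideanSpace.norm_eq, dotProduct]
  simp [Complex.mul_conj', ← Complex.ofReal_pow]

theorem norm_trace_mul_le (A M : Matrix κ κ ℂ) : ‖(A * M).trace‖ ≤ ‖A‖ * traceNorm M := by
  rw [trace_eq_sum_inner_mulVec _
    (Matrix.isHermitian_conjTranspose_mul_self M).eigenvectorBasis, traceNorm, Finset.mul_sum]
  refine norm_sum_le_of_le _ fun k _ => (norm_inner_le_norm _ _).trans ?_
  rw [OrthonormalBasis.norm_eq_one, one_mul, ← norm_toLp_mulVec_eigenvectorBasis,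
    ← Matrix.mulVec_mulVec]
  exact Matrix.l2_opNorm_mulVec A (toLp 2 (M.mulVec _))

theorem norm_sum_mul_diag_le_traceNorm (M : Matrix κ κ ℂ) {g : κ → ℂ} (hg : ∀ k, ‖g k‖ ≤ 1) :
    ‖∑ k, g k * M k k‖ ≤ traceNorm M := by
  have htrace : (Matrix.diagonal g * M).trace = ∑ k, g k * M k k := by
    simp [Matrix.trace, Matrix.diagonal_mul]
  rw [← htrace]
  refine (norm_trace_mul_le _ M).trans (mul_le_of_le_one_left (traceNorm_nonneg M) ?_)
  rw [Matrix.l2_opNorm_diagonal]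
  exact (pi_norm_le_iff_of_nonneg zero_le_one).2 hg

end TraceNorm

section CatStates

theorem compl_ne {V : Type*} [Nonempty V] (x : Bits V) : compl x ≠ x := fun h =>
  Bool.not_ne_self _ (congrFun h (Classical.arbitrary V))

variable {m : ℕ} {V : Type*} [Fintype V] [DecidableEq V] {I : Finset (Fin m)}

/-- The computational basis measurement of `σ` gives `x` and `x̄` with probability `1/2` each. -/
def HasCatDiagonal (x : Bits V) (σ : Op V) : Prop :=
  ∀ y, σ y y = (basisKet x y + basisKet (compl x) y) / 2

theorem norm_inv_sqrt_two_mul_add_sq [Nonempty V] (x y : Bits V) (α β : ℂ) :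
    ((‖((√2 : ℝ) : ℂ)⁻¹ * (basisKet x y * α + basisKet (compl x) y * β)‖ ^ 2 : ℝ) : ℂ) =
      (basisKet x y * (‖α‖ ^ 2 : ℝ) + basisKet (compl x) y * (‖β‖ ^ 2 : ℝ)) / 2 := by
  have hsqrt : ‖((√2 : ℝ) : ℂ)⁻¹‖ ^ 2 = 1 / 2 := by
    rw [norm_inv, Complex.norm_real, inv_pow, Real.norm_of_nonneg (Real.sqrt_nonneg _),
      Real.sq_sqrt zero_le_two, one_div]
  rw [norm_mul, mul_pow, hsqrt]
  have hne := compl_ne x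
  by_cases hx : y = x
  · simp [basisKet, hx, hne.symm]
    ring
  · by_cases hx' : y = compl x
    · simp [basisKet, hx', hne]
      ring
    · simp [basisKet, hx, hx']

theorem traceAnc_proj_apply_self (ψ : Ket (Fin m)) (y : Bits I) :
    traceAnc I (proj ψ) y y = ∑ a : Bits (Anc I), ((‖ψ (join I y a)‖ ^ 2 : ℝ) : ℂ) := by
  simp [traceAnc, proj, Matrix.vecMulVec_apply, Complex.mul_conj']

theorem hasCatDiagonal_traceAnc_proj_nekomataKet (hI : I.Nonempty) (x : Bits I)
    {ψ₀ ψ₁ : Ket (Anc I)} (h₀ : IsUnitKet ψ₀) (h₁ : IsUnitKet ψ₁) :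
    HasCatDiagonal x (traceAnc I (proj (nekomataKet I x ψ₀ ψ₁))) := by
  intro y
  have := hI.to_subtype
  simp only [traceAnc_proj_apply_self, nekomataKet, Pi.smul_apply, Pi.add_apply, tensor,
    join_input, join_anc, smul_eq_mul, norm_inv_sqrt_two_mul_add_sq]
  rw [← Finset.sum_div, Finset.sum_add_distrib, ← Finset.mul_sum, ← Finset.mul_sum,
    ← Complex.ofReal_sum, ← Complex.ofReal_sum, show ∑ a, ‖ψ₀ a‖ ^ 2 = 1 from h₀,
    show ∑ a, ‖ψ₁ a‖ ^ 2 = 1 from h₁, Complex.ofReal_one, mul_one, mul_one]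

theorem hasCatDiagonal_proj_catKet (hI : I.Nonempty) (x : Bits I) :
    HasCatDiagonal x (proj (catKet I x)) := by
  intro y
  have := hI.to_subtype
  have hproj : proj (catKet I x) y y = ((‖catKet I x y‖ ^ 2 : ℝ) : ℂ) := by
    simp [proj, Matrix.vecMulVec_apply, Complex.mul_conj']
  have h := norm_inv_sqrt_two_mul_add_sq x y 1 1
  rw [mul_one, mul_one] at h
  rw [hproj, catKet, Pi.smul_apply, smul_eq_mul, Pi.add_apply, h]
  simp

theorem HasCatDiagonal.sum_mul {x : Bits V} {σ : Op V} (h : HasCatDiagonal x σ)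
    (g : Bits V → ℂ) : ∑ y, g y * σ y y = (g x + g (compl x)) / 2 := by
  simp only [h _, basisKet, mul_div_assoc', mul_add, mul_ite, mul_one, mul_zero,
    ← Finset.sum_div, Finset.sum_add_distrib, Finset.sum_ite_eq', Finset.mem_univ, if_true]

theorem sum_join (I : Finset (Fin m)) (f : Bits (Fin m) → ℝ) :
    ∑ y : Bits I, ∑ a : Bits (Anc I), f (join I y a) = ∑ z, f z := by
  rw [← Fintype.sum_prod_type']
  exact Equiv.sum_comp (Equiv.piEquivPiSubtypeProd (· ∈ I) fun _ => Bool).symm f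

theorem sum_mul_traceAnc_proj (ψ : Ket (Fin m)) (g : Bits I → ℝ) :
    ∑ y, (g y : ℂ) * traceAnc I (proj ψ) y y = mean ψ fun z => g fun i => z i := by
  rw [mean, ← sum_join I]
  simp only [join_input, traceAnc_proj_apply_self, ← Finset.mul_sum, Complex.ofReal_sum,
    Complex.ofReal_mul]

end CatStates

section LowerBound

variable {m d d' : ℕ} {I : Finset (Fin m)}

theorem abs_mean_sub_le_traceNorm_add {C : Circuit m d} {C' : Circuit m d'} {x : Bits I}
    {σ : Op I} (hσ : HasCatDiagonal x σ) {g : Bits I → ℝ} (hg : ∀ y, |g y| ≤ 1) :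
    |mean (C'.output I x) (fun z => g fun i => z i) - (g x + g (compl x)) / 2| ≤
      traceNorm (traceAnc I (proj (C.output I x)) - σ) +
        2 * ‖toLp 2 (C.output I x - C'.output I x)‖ := by
  have htrace := norm_sum_mul_diag_le_traceNorm (traceAnc I (proj (C.output I x)) - σ)
    (g := fun y => (g y : ℂ)) fun y => (Complex.norm_real _).trans_le (hg y)
  simp only [Matrix.sub_apply, mul_sub, Finset.sum_sub_distrib] at htrace
  rw [sum_mul_traceAnc_proj, hσ.sum_mul] at htrace
  have hcast : ((g x : ℂ) + g (compl x)) / 2 = ((g x + g (compl x)) / 2 : ℝ) := by push_cast; rfl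
  rw [hcast, ← Complex.ofReal_sub, Complex.norm_real, Real.norm_eq_abs] at htrace
  have hmean := abs_mean_sub_mean_le (C.isUnitKet_output I x) (C'.isUnitKet_output I x)
    (f := fun z : Bits (Fin m) => g fun i => z i) fun _ => hg _
  rw [abs_sub_comm] at hmean
  linarith [abs_sub_le (mean (C'.output I x) fun z => g fun i => z i)
    (mean (C.output I x) fun z => g fun i => z i) ((g x + g (compl x)) / 2)]

theorem three_fifths_le_of_abs_mul_sub_le {a b s G : ℝ} (hs : |s| = 1) (ha : |a| ≤ G)
    (hb : |b| ≤ G) (hab : |a * b - s| ≤ G) : 3 / 5 ≤ G := by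
  have hprod : |a * b| ≤ G * G :=
    (abs_mul a b).trans_le (mul_le_mul ha hb (abs_nonneg b) ((abs_nonneg a).trans ha))
  have hone : 1 ≤ G * G + G := by
    linarith [abs_sub_abs_le_abs_sub s (a * b), abs_sub_comm s (a * b)]
  by_contra! hlt
  nlinarith [(abs_nonneg a).trans ha]

/-- The two bits are uncorrelated in the output of `C'`, whereas in `σ` each of them is unbiased
and they determine one another. -/
theorem Circuit.three_fifths_le_traceNorm_add (C : Circuit m d) (C' : Circuit m d') {i j : Fin m}
    (hi : i ∈ I) (hj : j ∈ I) (h : Disjoint (C'.backCone {i}) (C'.backCone {j})) {x : Bits I}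
    {σ : Op I} (hσ : HasCatDiagonal x σ) :
    3 / 5 ≤ traceNorm (traceAnc I (proj (C.output I x)) - σ) +
      2 * ‖toLp 2 (C.output I x - C'.output I x)‖ := by
  have habs : |sign (x ⟨i, hi⟩) * sign (x ⟨j, hj⟩)| = 1 := by
    rw [abs_mul, abs_sign, abs_sign, one_mul]
  have hbit (k : I) : |mean (C'.output I x) fun z => sign (z k)| ≤
      traceNorm (traceAnc I (proj (C.output I x)) - σ) +
        2 * ‖toLp 2 (C.output I x - C'.output I x)‖ := by
    simpa only [compl, sign_not, add_neg_cancel, zero_div, sub_zero] using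
      abs_mean_sub_le_traceNorm_add (C := C) (C' := C') hσ (g := fun y => sign (y k))
        fun y => (abs_sign _).le
  have hpair := abs_mean_sub_le_traceNorm_add (C := C) (C' := C') hσ
    (g := fun y => sign (y ⟨i, hi⟩) * sign (y ⟨j, hj⟩)) fun y => by
      rw [abs_mul, abs_sign, abs_sign, one_mul]
  simp only [compl, sign_not, neg_mul_neg, add_self_div_two,
    C'.mean_output_sign_mul_sign h] at hpair
  exact three_fifths_le_of_abs_mul_sub_le habs (hbit ⟨i, hi⟩) (hbit ⟨j, hj⟩) hpair

theorem Circuit.three_fifths_sub_le_expect_traceNorm (C : Circuit m d) {τ : ℕ} (hτ : 0 < τ)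
    (hI : 2 ^ (d + 2) * τ < I.card) {σ : Bits I → Op I} (hσ : ∀ x, HasCatDiagonal x (σ x)) :
    3 / 5 - 4 * d * √(I.card / 2 ^ τ) ≤
      expect I fun x => traceNorm (traceAnc I (proj (C.output I x)) - σ x) := by
  obtain ⟨i, hi, j, hj, hij⟩ := C.exists_disjoint_backCone_prune hτ hI
  have hmean := Finset.expect_le_expect fun x (_ : x ∈ Finset.univ) =>
    C.three_fifths_le_traceNorm_add (C.prune I τ) hi hj hij (hσ x)
  rw [Fintype.expect_const, Finset.expect_add_distrib, ← Finset.mul_expect] at hmean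
  rw [expect_eq]
  linarith [C.expect_norm_output_sub_prune_le I hτ]

end LowerBound

section Numerics

variable {n ε t : ℝ} {d : ℕ}

theorem sqrt_div_two_pow_le (hn : 1 ≤ n) (hε : 0 < ε) {τ : ℕ}
    (hτ : 2 * Real.logb 2 (n / ε) ≤ τ) : √(n / 2 ^ τ) ≤ ε := by
  have hpow : (n / ε) ^ 2 ≤ 2 ^ τ :=
    calc (n / ε) ^ 2 = (2 : ℝ) ^ (2 * Real.logb 2 (n / ε)) := by
          rw [mul_comm, Real.rpow_mul zero_le_two,
            Real.rpow_logb two_pos (by norm_num) (by positivity), Real.rpow_two]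
      _ ≤ 2 ^ τ := by
          rw [← Real.rpow_natCast]
          exact Real.rpow_le_rpow_of_exponent_le one_le_two hτ
  rw [Real.sqrt_le_left hε.le, div_le_iff₀ (by positivity)]
  calc n ≤ n ^ 2 := le_self_pow₀ hn two_ne_zero
    _ = ε ^ 2 * (n / ε) ^ 2 := by field_simp
    _ ≤ ε ^ 2 * 2 ^ τ := by gcongr

theorem two_pow_mul_ceil_lt (hd : 1 ≤ d) (ht : 2 ≤ t) (hn : 20 < n / t ^ d) :
    2 ^ (d + 2) * (⌈2 * t⌉₊ : ℝ) < n := by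
  obtain ⟨e, rfl⟩ := Nat.exists_eq_add_of_le' hd
  have hceil : (⌈2 * t⌉₊ : ℝ) < 2 * t + 1 := Nat.ceil_lt_add_one (by linarith)
  calc 2 ^ (e + 1 + 2) * (⌈2 * t⌉₊ : ℝ) = 8 * 2 ^ e * ⌈2 * t⌉₊ := by ring
    _ ≤ 8 * t ^ e * (5 / 2 * t) := by gcongr; linarith
    _ = 20 * t ^ (e + 1) := by ring
    _ < n := (lt_div_iff₀ (by positivity)).1 hn

theorem twenty_lt_of_two_rpow_lt {r : ℝ} (h : (2 : ℝ) ^ (-(1 / 40 * (r - 1))) < 3 / 5) :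
    20 < r := by
  -- The factor `1 / 40` only has to make the power at least `3 / 5` at `r = 20`.
  have hsqrt : (3 / 5 : ℝ) < 2 ^ (-(1 / 2) : ℝ) := by
    rw [Real.rpow_neg zero_le_two, ← Real.sqrt_eq_rpow, lt_inv_comm₀ (by norm_num) (by positivity),
      Real.sqrt_lt' (by norm_num)]
    norm_num
  linarith [(Real.rpow_lt_rpow_left_iff one_lt_two).1 (h.trans hsqrt)]

theorem two_le_logb_div (hn : 1 ≤ n) (hε : 0 < ε) (hε' : ε ≤ 1 / 4) :
    2 ≤ Real.logb 2 (n / ε) := by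
  rw [Real.le_logb_iff_rpow_le one_lt_two (by positivity), le_div_iff₀ hε, Real.rpow_two]
  linarith

end Numerics

end QACLine

theorem mainTheorem9_general {m d : ℕ} {I : Finset (Fin m)} (hI : I.Nonempty) (hd : 1 ≤ d)
    {ε t : ℝ} (hε : 0 < ε) (ht : t = Real.logb 2 (I.card / ε)) (C : QACLine.Circuit m d)
    {σ : QACLine.Bits I → QACLine.Op I} (hσ : ∀ x, QACLine.HasCatDiagonal x (σ x)) :
    3 / 5 - (2 : ℝ) ^ (-(1 / 40 * (I.card / t ^ d - 1))) - 4 * d * ε ≤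
      QACLine.expect I fun x =>
        QACLine.traceNorm (QACLine.traceAnc I (QACLine.proj (C.output I x)) - σ x) := by
  subst ht
  set t := Real.logb 2 (I.card / ε)
  have hpow : 0 < (2 : ℝ) ^ (-(1 / 40 * (I.card / t ^ d - 1))) := by positivity
  have hdε : ε ≤ d * ε := le_mul_of_one_le_left hε.le (mod_cast hd)
  rcases le_or_gt (3 / 5 - (2 : ℝ) ^ (-(1 / 40 * (I.card / t ^ d - 1))) - 4 * d * ε) 0
    with hneg | hpos
  · rw [QACLine.expect_eq]
    exact hneg.trans (Finset.expect_nonneg fun x _ => QACLine.traceNorm_nonneg _)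
  have hn : (1 : ℝ) ≤ I.card := mod_cast hI.card_pos
  have ht : 2 ≤ t := QACLine.two_le_logb_div hn hε (by linarith)
  have hratio : 20 < I.card / t ^ d := QACLine.twenty_lt_of_two_rpow_lt (by linarith)
  have hcard : 2 ^ (d + 2) * ⌈2 * t⌉₊ < I.card := mod_cast QACLine.two_pow_mul_ceil_lt hd ht hratio
  have hbound := C.three_fifths_sub_le_expect_traceNorm (Nat.ceil_pos.2 (by linarith)) hcard hσ
  have herror : 4 * (d : ℝ) * √(I.card / 2 ^ ⌈2 * t⌉₊) ≤ 4 * d * ε := by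
    gcongr
    exact QACLine.sqrt_div_two_pow_le hn hε (Nat.le_ceil _)
  linarith

theorem mainTheorem9 :
    ∃ c : ℝ, 0 < c ∧
      ∀ (n d : ℕ) (ε t : ℝ), 1 ≤ n → 1 ≤ d → 0 < ε → ε < 1 → t = Real.logb 2 ((n : ℝ) / ε) →
        ∀ (m : ℕ) (I : Finset (Fin m)), I.card = n → ∀ C : QACLine.Circuit m d,
          (∀ ψ₀ ψ₁ : QACLine.Bits I → QACLine.Ket (QACLine.Anc I),
            (∀ x, QACLine.IsUnitKet (ψ₀ x)) → (∀ x, QACLine.IsUnitKet (ψ₁ x)) →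
            1 / 8 - (2 : ℝ) ^ (-(c * ((n : ℝ) / t ^ d - 1))) - 16 * (d : ℝ) * ε ≤
              QACLine.expect I fun x =>
                QACLine.traceNorm
                  (QACLine.traceAnc I (QACLine.proj (C.output I x)) -
                    QACLine.traceAnc I (QACLine.proj (QACLine.nekomataKet I x (ψ₀ x) (ψ₁ x))))) ∧
          1 / 8 - (2 : ℝ) ^ (-(c * ((n : ℝ) / t ^ d - 1))) - 16 * (d : ℝ) * ε ≤
            QACLine.expect I fun x =>
              QACLine.traceNorm
                (QACLine.traceAnc I (QACLine.proj (C.output I x)) -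
                  QACLine.proj (QACLine.catKet I x)) := by
  refine ⟨1 / 40, by norm_num, fun n d ε t hn hd hε _ ht m I hI C => ?_⟩
  subst hI
  have hne : I.Nonempty := Finset.card_pos.1 hn
  have hdε : 0 ≤ (d : ℝ) * ε := by positivity
  refine ⟨fun ψ₀ ψ₁ h₀ h₁ => ?_, ?_⟩
  · linarith [mainTheorem9_general hne hd hε ht C fun x =>
      QACLine.hasCatDiagonal_traceAnc_proj_nekomataKet hne x (h₀ x) (h₁ x)]
  · linarith [mainTheorem9_general hne hd hε ht C fun x => QACLine.hasCatDiagonal_proj_catKet hne x]
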